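/- Let $\mathcal{T}=(\mathcal T,\Sigma)$ be a triangulated category that is $\mathbb{Z}/m$-graded for some $1\le m\le\infty$, meaning that $\Sigma^m\cong\operatorname{id}_{\mathcal T}$ if $m<\infty$, with no condition if $m=\infty$. Set $\operatorname{Hom}^\bullet_{\mathcal T}(X,Y)=\bigoplus_{i=1}^{m}\operatorname{Hom}_{\mathcal T}(X,\Sigma^iY)$ if $m<\infty$ and $\operatorname{Hom}^\bullet_{\mathcal T}(X,Y)=\bigoplus_{i\in\mathbb Z}\operatorname{Hom}_{\mathcal T}(X,\Sigma^iY)$ if $m=\infty$. Let $k$ be a field and let $R$ be a commutative $k$-algebra of finite type (ungraded, i.e. placed in degree $0$) acting centrally on $\mathcal T$: there is given a ring homomorphism from $R$ to the ring of natural transformations $\eta\colon\operatorname{id}_{\mathcal T}\to\operatorname{id}_{\mathcal T}$ satisfying $\eta\Sigma=\Sigma\eta$. Through it, every $\operatorname{Hom}^\bullet_{\mathcal T}(X,Y)$ is an $R$-module. For an object $G$, let $\langle G\rangle_1$ be the smallest strictly full subcategory of $\mathcal T$ that contains $G$ and is closed under shifts, finite direct sums and direct summands. For $n\ge1$, let $\langle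 G\rangle_{n+1}$ be the smallest strictly full subcategory closed under shifts, finite direct sums and direct summands that contains every object $K$ fitting into a distinguished triangle $K_0\to K\to K_1\to\Sigma K_0$ with $K_0\in\langle G\rangle_{n}$ and $K_1\in\langle G\rangle_1$. The object $G$ is a split-generator if $\mathcal T=\bigcup_{n\ge 1}\langle G\rangle_n$. The Rouquier dimension $\operatorname{rdim}\mathcal T\in\mathbb N\cup\{\infty\}$ is the smallest $n$ such that $\mathcal T=\langle G'\rangle_{n+1}$ for some object $G'$, and $\infty$ if there is no such $n$. Suppose that $G\in\mathcal T$ is a split-generator such that $\operatorname{Hom}^\bullet_{\mathcal T}(G,G)$ is a Noetherian $R$-module. Then $$\operatorname{rdim}\mathcal T\;\ge\;\dim_R\operatorname{Hom}^\bullet_{\mathcal T}(G,G),$$ where $\dim_R M$ denotes the Krull dimension of the ring $R/\operatorname{Ann}_R(M)$ (equal to $-\infty$ if $M=0$). -/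

import Mathlib

open CategoryTheory CategoryTheory.Limits
open scoped DirectSum

universe w v u

noncomputable section

section Definitions

variable (C : Type u) [Category.{v} C] [Preadditive C] [HasShift C ℤ]

/-- The shift functor `Σ = ⟦1⟧` makes `C` a `ℤ/m`-graded category, where `ℤ/∞ = ℤ`: for finite `m`,
the functor `Σᵐ` is isomorphic to the identity; for `m = ⊤` there is no condition. -/
def IsCyclicallyGraded (m : ℕ∞) : Prop :=
  ∀ n : ℕ, m = n → Nonempty (shiftFunctor C (n : ℤ) ≅ 𝟭 C)

/-- The degree zero part of the graded center of `C`: natural endomorphisms `η` of the identity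
functor with `η Σ = Σ η`. -/
def gradedCenterZero [∀ n : ℤ, (shiftFunctor C n).Additive] : Subring (CatCenter C) where
  carrier := {z | ∀ X : C, z.app (X⟦(1 : ℤ)⟧) = (z.app X)⟦(1 : ℤ)⟧'}
  one_mem' X := ((shiftFunctor C (1 : ℤ)).map_id X).symm
  mul_mem' {x y} hx hy X := by
    rw [CatCenter.mul_app', CatCenter.mul_app', Functor.map_comp, hx X, hy X]
  zero_mem' X := ((shiftFunctor C (1 : ℤ)).map_zero X X).symm
  add_mem' {x y} hx hy X := by
    change x.app (X⟦(1 : ℤ)⟧) + y.app (X⟦(1 : ℤ)⟧) = (shiftFunctor C (1 : ℤ)).map (x.app X + y.app X)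
    rw [Functor.map_add, hx X, hy X]
  neg_mem' {x} hx X := by
    change -x.app (X⟦(1 : ℤ)⟧) = (shiftFunctor C (1 : ℤ)).map (-x.app X)
    rw [Functor.map_neg, hx X]

/-- A central action on `C` of a commutative ring `R`, placed in degree zero: a ring morphism
from `R` to the graded center of `C`, which necessarily lands in degree zero. -/
abbrev CentralAction (R : Type w) [CommRing R] [∀ n : ℤ, (shiftFunctor C n).Additive] :=
  R →+* gradedCenterZero C

end Definitions

/-- The degrees over which `Hom^•` is summed: `1, …, m` for finite `m`, all integers for `m = ∞`. -/
def gradingDegrees (m : ℕ∞) : Set ℤ :=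
  if m = ⊤ then Set.univ else Set.Icc 1 (m.toNat : ℤ)

section GradedHom

variable {C : Type u} [Category.{v} C] [Preadditive C] [HasShift C ℤ]
  [∀ n : ℤ, (shiftFunctor C n).Additive] {R : Type w} [CommRing R]

/-- `Hom(X, Σⁱ Y)`, to be regarded as an `R`-module through the central action `φ`. -/
def HomInDegree (_φ : CentralAction C R) (X Y : C) (i : ℤ) : Type v := X ⟶ Y⟦i⟧

instance (φ : CentralAction C R) (X Y : C) (i : ℤ) : AddCommGroup (HomInDegree φ X Y i) :=
  inferInstanceAs (AddCommGroup (X ⟶ Y⟦i⟧))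

/-- The scalar `r` acts on `f : X ⟶ Σⁱ Y` by `r • f = φ(r)_X ≫ f`, which is also
`f ≫ φ(r)_{Σⁱ Y}` by naturality. -/
instance (φ : CentralAction C R) (X Y : C) (i : ℤ) : Module R (HomInDegree φ X Y i) :=
  Linear.homModuleOfRingMorphism ((gradedCenterZero C).subtype.comp φ) X (Y⟦i⟧)

/-- The `R`-module `Hom^•(X, Y) = ⨁ᵢ Hom(X, Σⁱ Y)` of a `ℤ/m`-graded category. -/
abbrev GradedHom (φ : CentralAction C R) (m : ℕ∞) (X Y : C) : Type v :=
  ⨁ i : gradingDegrees m, HomInDegree φ X Y (i : ℤ)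

end GradedHom

section Rouquier

variable (C : Type u) [Category.{v} C] [HasZeroObject C] [HasShift C ℤ] [Preadditive C]
  [∀ n : ℤ, (shiftFunctor C n).Additive] [Pretriangulated C]

/-- The Rouquier dimension: the smallest `n` such that some object `G` satisfies
`⟨G⟩_{n+1} = C`, and `∞` if there is none. Here `⟨G⟩_{n+1}`, the objects obtained from `G` by
shifts, finite sums, summands and `n` extensions, is Mathlib's `triangEnvelopeIter n`. -/
def rouquierDim : ℕ∞ :=
  sInf {d : ℕ∞ | ∃ n : ℕ, d = n ∧
    ∃ G : C, (ObjectProperty.singleton G).triangEnvelopeIter n = ⊤}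

variable {C} in
/-- `G` is a split-generator: every object is obtained from `G` by finitely many shifts, finite
sums, cones and summands, that is `⟨G⟩_∞ = C`. -/
def IsSplitGenerator (G : C) : Prop :=
  (ObjectProperty.singleton G).IsClassicalTriangulatedGenerator

end Rouquier

/-- The Krull dimension `dim (R / Ann M)` of a finitely generated module `M`; it is `⊥` for
`M = 0`. -/
def moduleKrullDim (R : Type*) [CommRing R] (M : Type*) [AddCommGroup M] [Module R M] :
    WithBot ℕ∞ :=
  ringKrullDim (R ⧸ Module.annihilator R M)

end

/-! Suppose `G'` builds every object by `n` extensions. By the ghost lemma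
(`IsGhostComposite.comp_eq_zero`) all composites of `n + 1` `G'`-ghosts vanish, so it suffices that
a chain of primes p₀ < p₁ < … of length above `n` yields a nonzero one. Start from the identity of
`G'` and climb the chain: `exists_ghost_comp_of_lt` precomposes a map u : X ⟶ Z nonzero at p with a
ghost so that the result is nonzero at q > p. For x in q but not in p, let d be the fibre of x^a on
X. Since x^a kills d, the map x^N d is a ghost once x^N kills the x-power torsion of every Hom(Σʲ
G', X); for large a its composite with u survives at q by Krull's intersection theorem. Such an N
exists since the Hom modules are Noetherian (dévissage from `G`) and finitely many j suffice: almost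
all Homs vanish if m = ∞, and shifts are periodic otherwise. -/

/-! ### Ghost maps and the ghost lemma. -/

section Ghost

open Pretriangulated

variable {C : Type*} [Category* C] [HasShift C ℤ] [Preadditive C]

/-- The objects `W` such that every morphism from a shift of `W` to `X` is killed by `f : X ⟶ Y`. -/
def shiftKilledBy {X Y : C} (f : X ⟶ Y) : ObjectProperty C :=
  fun W => ∀ (j : ℤ) (h : W⟦j⟧ ⟶ X), h ≫ f = 0

lemma shiftKilledBy.comp_eq_zero {X Y W : C} {f : X ⟶ Y} (hW : shiftKilledBy f W)
    (h : W ⟶ X) : h ≫ f = 0 := by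
  have := hW 0 ((shiftFunctorZero C ℤ).hom.app W ≫ h)
  rw [Category.assoc] at this
  exact (cancel_epi ((shiftFunctorZero C ℤ).hom.app W)).1 (this.trans comp_zero.symm)

variable [HasZeroObject C] [∀ n : ℤ, (shiftFunctor C n).Additive] [Pretriangulated C]

instance {X Y : C} (f : X ⟶ Y) : (shiftKilledBy f).IsStableUnderRetracts where
  of_retract {V W} r hW j h := by
    have := hW j (r.r⟦j⟧' ≫ h)
    rw [← Category.id_comp h, ← (shiftFunctor C j).map_id, ← r.retract, Functor.map_comp, Category.assoc,
      Category.assoc, ← Category.assoc (r.r⟦j⟧'), this, comp_zero]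

instance {X Y : C} (f : X ⟶ Y) : (shiftKilledBy f).IsStableUnderShift ℤ where
  isStableUnderShiftBy a := .mk fun W hW j h => by
    rw [← cancel_epi ((shiftFunctorAdd C a j).hom.app W), comp_zero, ← Category.assoc]
    exact hW (a + j) _

instance {X Y : C} (f : X ⟶ Y) : (shiftKilledBy f).ContainsZero where
  exists_zero := ⟨_, isZero_zero C, fun j h => by
    rw [((shiftFunctor C j).map_isZero (isZero_zero C)).eq_of_src h 0, zero_comp]⟩

lemma shiftKilledBy_biprod {X Y : C} (f : X ⟶ Y) {A B : C} (hA : shiftKilledBy f A)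
    (hB : shiftKilledBy f B) : shiftKilledBy f (A ⊞ B) := fun j h => by
  rw [← Category.id_comp h, ← (shiftFunctor C j).map_id, ← biprod.total, Functor.map_add,
    Functor.map_comp, Functor.map_comp, Preadditive.add_comp, Preadditive.add_comp]
  simp only [Category.assoc]
  have h₁ := hA j (biprod.inl⟦j⟧' ≫ h)
  have h₂ := hB j (biprod.inr⟦j⟧' ≫ h)
  rw [Category.assoc] at h₁ h₂
  rw [h₁, h₂, comp_zero, comp_zero, add_zero]

instance {X Y : C} (f : X ⟶ Y) : (shiftKilledBy f).IsClosedUnderBinaryProducts :=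
  .mk' (by
    rintro _ ⟨F, hF⟩
    refine (shiftKilledBy f).prop_of_iso ?_
      (shiftKilledBy_biprod f (hF ⟨.left⟩) (hF ⟨.right⟩))
    exact biprod.isoProd _ _ ≪≫ (HasLimit.isoOfNatIso (diagramIsoPair F)).symm)

lemma triangEnvelopeIter_zero_le_shiftKilledBy {G X Y : C} {f : X ⟶ Y}
    (hf : shiftKilledBy f G) :
    (ObjectProperty.singleton G).triangEnvelopeIter 0 ≤ shiftKilledBy f := by
  rw [ObjectProperty.triangEnvelopeIter_zero, ObjectProperty.retractClosure_le_iff,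
    ObjectProperty.binaryProductsClosure_le_iff, ObjectProperty.shiftClosure_le_iff]
  simpa using hf

/-- Composites of `n` morphisms that are `G`-ghosts, i.e. that kill all morphisms from shifts
of `G`. -/
inductive IsGhostComposite (G : C) : ℕ → ∀ {X Y : C}, (X ⟶ Y) → Prop
  | id (X : C) : IsGhostComposite G 0 (𝟙 X)
  | comp {n : ℕ} {X Y Z : C} (f : X ⟶ Y) (g : Y ⟶ Z) (hf : shiftKilledBy f G)
      (hg : IsGhostComposite G n g) : IsGhostComposite G (n + 1) (f ≫ g)

/-- The ghost lemma: a composite of `n + 1` ghosts kills all morphisms from objects that are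
built from `G` by `n` extensions. -/
lemma IsGhostComposite.comp_eq_zero {G : C} {n : ℕ} {X Y : C} {u : X ⟶ Y}
    (hu : IsGhostComposite G (n + 1) u) {W : C}
    (hW : (ObjectProperty.singleton G).triangEnvelopeIter n W) (h : W ⟶ X) : h ≫ u = 0 := by
  induction n generalizing X W with
  | zero =>
    cases hu with
    | comp f g hf hg =>
      rw [← Category.assoc,
        (triangEnvelopeIter_zero_le_shiftKilledBy hf _ hW).comp_eq_zero h, zero_comp]
  | succ n ih =>
    cases hu with
    | comp f g hf hg =>
      rw [ObjectProperty.triangEnvelopeIter_succ] at hW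
      obtain ⟨W', ⟨A, B, a, b, c, hT, hA, hB⟩, ⟨r⟩⟩ := hW
      rw [← ObjectProperty.triangEnvelopeIter_zero] at hA
      -- The first ghost kills the part `A` built without extensions; the map then factors through
      -- `B`, where the remaining ghosts vanish by induction.
      have h₀ : a ≫ r.r ≫ h ≫ f = 0 := by
        have := (triangEnvelopeIter_zero_le_shiftKilledBy hf _ hA).comp_eq_zero (a ≫ r.r ≫ h)
        simpa only [Category.assoc] using this
      obtain ⟨t : B ⟶ _, ht : r.r ≫ h ≫ f = b ≫ t⟩ := Triangle.yoneda_exact₂ _ hT (r.r ≫ h ≫ f) h₀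
      have h₁ := ih hg hB t
      rw [← Category.id_comp h, ← r.retract]
      simp only [Category.assoc]
      have : r.r ≫ h ≫ f ≫ g = 0 := by
        have := congr($ht ≫ g)
        simpa only [Category.assoc, h₁, comp_zero] using this
      rw [this, comp_zero]

end Ghost

/-! ### Power torsion and Krull's intersection theorem. -/

section CommutativeAlgebra

variable {R : Type*} [CommRing R] {M : Type*} [AddCommGroup M] [Module R M]

/-- The ascending chain of kernels of the powers of `x` stabilizes. -/
lemma exists_pow_smul_eq_zero_of_isNoetherian [IsNoetherian R M] (x : R) :
    ∃ N : ℕ, ∀ n, N ≤ n → ∀ (h : M) (a : ℕ), x ^ a • h = 0 → x ^ n • h = 0 := by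
  obtain ⟨N, hN⟩ := Filter.eventually_atTop.1
    (LinearMap.eventually_iSup_ker_pow_eq (algebraMap R (Module.End R M) x))
  have key (n : ℕ) (h : M) :
      h ∈ LinearMap.ker (algebraMap R (Module.End R M) x ^ n) ↔ x ^ n • h = 0 := by
    rw [LinearMap.mem_ker, ← map_pow, Module.algebraMap_end_apply]
  refine ⟨N, fun n hn h a ha => ?_⟩
  rw [← key, ← hN n hn]
  exact Submodule.mem_iSup_of_mem a ((key a h).2 ha)

/-- A form of Krull's intersection theorem: if `v` is nonzero at the prime `p` and `x ∈ p`, then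
`v` is nonzero at `p` modulo a large power of `x`. -/
lemma exists_mem_of_smul_mem_pow_smul [IsNoetherianRing R] [Module.Finite R M] (p : Ideal R)
    [p.IsPrime] {x : R} (hx : x ∈ p) (v : M) (hv : ∀ r : R, r • v = 0 → r ∈ p) :
    ∃ a : ℕ, ∀ (r : R) (h : M), r • v = x ^ a • h → r ∈ p := by
  let A := Localization.AtPrime p
  let L := LocalizedModule p.primeCompl M
  let ι := LocalizedModule.mkLinearMap p.primeCompl M
  have hv' : ι v ≠ 0 := fun h => by
    obtain ⟨c, hc⟩ := (IsLocalizedModule.eq_zero_iff p.primeCompl ι).1 h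
    exact c.2 (hv _ hc)
  have hbot := Ideal.iInf_pow_smul_eq_bot_of_isLocalRing (R := A) (M := L)
    (IsLocalRing.maximalIdeal A) (Ideal.IsPrime.ne_top inferInstance)
  have hnot : ι v ∉ (⨅ i : ℕ, IsLocalRing.maximalIdeal A ^ i • ⊤ : Submodule A L) := by
    rw [hbot]; exact hv'
  rw [Submodule.mem_iInf, not_forall] at hnot
  obtain ⟨a, ha⟩ := hnot
  refine ⟨a, fun r h hr => by_contra fun hrp => ha ?_⟩
  have hxm : algebraMap R A x ∈ IsLocalRing.maximalIdeal A :=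
    (IsLocalization.AtPrime.to_map_mem_maximal_iff A p x).2 hx
  have hunit : IsUnit (algebraMap R A r) := IsLocalization.map_units A (⟨r, hrp⟩ : p.primeCompl)
  have : algebraMap R A r • ι v ∈ (IsLocalRing.maximalIdeal A ^ a • ⊤ : Submodule A L) := by
    rw [algebraMap_smul, ← map_smul, hr, map_smul, ← algebraMap_smul A (x ^ a), map_pow]
    exact Submodule.smul_mem_smul (Ideal.pow_mem_pow hxm a) trivial
  obtain ⟨s, hs⟩ := hunit.exists_left_inv
  have := Submodule.smul_mem _ s this
  rwa [smul_smul, hs, one_smul] at this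

end CommutativeAlgebra

/-! ### Dévissage of finiteness of Hom modules. -/

section Finiteness

open Pretriangulated

variable (R : Type*) [CommRing R] {C : Type*} [Category* C] [HasShift C ℤ]
  [Preadditive C] [Linear R C]

/-- The `R`-modules `Hom(Σʲ X, Y)` are Noetherian and, in case `b` holds, all but finitely many
of them vanish. -/
structure HomFinite (b : Prop) (X Y : C) : Prop where
  isNoetherian (j : ℤ) : IsNoetherian R (X⟦j⟧ ⟶ Y)
  finite (hb : b) : {j : ℤ | ¬ Subsingleton (X⟦j⟧ ⟶ Y)}.Finite

variable {R}

lemma HomFinite.of_injective {b : Prop} {X Y X' Y' : C} (h : HomFinite R b X Y) {e : ℤ → ℤ}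
    (he : Function.Injective e) (f : ∀ j : ℤ, (X'⟦j⟧ ⟶ Y') →ₗ[R] (X⟦e j⟧ ⟶ Y))
    (hf : ∀ j, Function.Injective (f j)) : HomFinite R b X' Y' where
  isNoetherian j :=
    have := h.isNoetherian (e j)
    isNoetherian_of_injective (f j) (hf j)
  finite hb := by
    refine ((h.finite hb).preimage he.injOn).subset fun j hj hs => hj ?_
    exact (hf j).subsingleton

lemma HomFinite.of_exact {b : Prop} {X₁ Y₁ X₂ Y₂ X₃ Y₃ : C} (h₁ : HomFinite R b X₁ Y₁)
    (h₃ : HomFinite R b X₃ Y₃) (f : ∀ j : ℤ, (X₁⟦j⟧ ⟶ Y₁) →ₗ[R] (X₂⟦j⟧ ⟶ Y₂))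
    (g : ∀ j : ℤ, (X₂⟦j⟧ ⟶ Y₂) →ₗ[R] (X₃⟦j⟧ ⟶ Y₃)) (hfg : ∀ j, Function.Exact (f j) (g j)) :
    HomFinite R b X₂ Y₂ where
  isNoetherian j :=
    have := h₁.isNoetherian j
    have := h₃.isNoetherian j
    isNoetherian_of_range_eq_ker (f j) (g j) (hfg j).linearMap_ker_eq.symm
  finite hb := by
    refine ((h₁.finite hb).union (h₃.finite hb)).subset fun j hj => ?_
    by_contra hj'
    simp only [Set.mem_union, Set.mem_ofPred_eq, not_or, not_not] at hj'
    obtain ⟨_, _⟩ := hj'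
    refine hj (subsingleton_of_forall_eq 0 fun y => ?_)
    obtain ⟨z, rfl⟩ := (hfg j y).1 (Subsingleton.elim _ _)
    rw [Subsingleton.elim z 0, map_zero]

lemma HomFinite.of_forall_subsingleton {b : Prop} {X Y : C}
    (h : ∀ j : ℤ, Subsingleton (X⟦j⟧ ⟶ Y)) : HomFinite R b X Y where
  isNoetherian j := have := h j; inferInstance
  finite _ := by simp [h]

variable [∀ n : ℤ, (shiftFunctor C n).Additive] [∀ n : ℤ, (shiftFunctor C n).Linear R]

variable (R) in
/-- Shifting identifies `Hom(Σᵃ X, Σᶜ Y)` with `Hom(X, Σᵇ Y)` when `b + a = c`. -/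
noncomputable def shiftHomLinearEquiv (X Y : C) (a b c : ℤ) (h : b + a = c) :
    (X ⟶ Y⟦b⟧) ≃ₗ[R] (X⟦a⟧ ⟶ Y⟦c⟧) :=
  (LinearEquiv.ofBijective ((shiftFunctor C a).mapLinearMap R)
    ((Functor.FullyFaithful.ofFullyFaithful (shiftFunctor C a)).map_bijective X (Y⟦b⟧))).trans
    (Linear.homCongr R (Iso.refl _) ((shiftFunctorAdd' C b a c h).symm.app Y))

variable (R) in
/-- Shifting identifies `Hom(Σᵃ X, Y)` with `Hom(X, Σᵇ Y)` when `b + a = 0`. -/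
noncomputable def homShiftNegLinearEquiv (X Y : C) (a b : ℤ) (h : b + a = 0) :
    (X ⟶ Y⟦b⟧) ≃ₗ[R] (X⟦a⟧ ⟶ Y) :=
  (shiftHomLinearEquiv R X Y a b 0 h).trans
    (Linear.homCongr R (Iso.refl _) ((shiftFunctorZero C ℤ).app Y))

variable [HasZeroObject C] [Pretriangulated C]

variable (R) in
/-- The objects `Y` with `HomFinite R b X Y`. -/
def homFiniteTarget (b : Prop) (X : C) : ObjectProperty C := fun Y => HomFinite R b X Y

variable (R) in
/-- The objects `X` with `HomFinite R b X Y`. -/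
def homFiniteSource (b : Prop) (Y : C) : ObjectProperty C := fun X => HomFinite R b X Y

instance (b : Prop) (X : C) : (homFiniteTarget R b X).IsStableUnderRetracts where
  of_retract {V W} r hW := by
    refine HomFinite.of_injective hW Function.injective_id
      (fun j => Linear.rightComp R (X⟦j⟧) r.i) fun j f g hfg => ?_
    have := congr($hfg ≫ r.r)
    simpa using this

instance (b : Prop) (Y : C) : (homFiniteSource R b Y).IsStableUnderRetracts where
  of_retract {V W} r hW := by
    refine HomFinite.of_injective hW Function.injective_id
      (fun j => Linear.leftComp R Y (r.r⟦j⟧')) fun j f g hfg => ?_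
    have := congr(r.i⟦j⟧' ≫ $hfg)
    simpa [← Functor.map_comp_assoc] using this

instance (b : Prop) (X : C) : (homFiniteTarget R b X).IsTriangulated where
  exists_zero := ⟨_, isZero_zero C, .of_forall_subsingleton fun j =>
    ⟨fun f g => (isZero_zero C).eq_of_tgt f g⟩⟩
  isStableUnderShiftBy a := .mk fun Y hY => by
    refine HomFinite.of_injective hY (add_right_injective (-a)) (fun j =>
      ((homShiftNegLinearEquiv R (X⟦j⟧) Y (-a) a (by simp)).trans
        (Linear.homCongr R ((shiftFunctorAdd' C j (-a) (-a + j) (by lia)).symm.app X)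
          (Iso.refl _))).toLinearMap) fun j => LinearEquiv.injective _
  toIsTriangulatedClosed₂ := .mk' fun T hT h₁ h₃ =>
    HomFinite.of_exact h₁ h₃ (fun j => Linear.rightComp R _ T.mor₁)
      (fun j => Linear.rightComp R _ T.mor₂) fun j y => by
        refine ⟨fun hy => ?_, ?_⟩
        · obtain ⟨z, hz⟩ := T.coyoneda_exact₂ hT y hy
          exact ⟨z, hz.symm⟩
        · rintro ⟨z, rfl⟩
          simp [comp_distTriang_mor_zero₁₂ _ hT]

instance (b : Prop) (Y : C) : (homFiniteSource R b Y).IsTriangulated where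
  exists_zero := ⟨_, isZero_zero C, .of_forall_subsingleton fun j =>
    ⟨fun f g => ((shiftFunctor C j).map_isZero (isZero_zero C)).eq_of_src f g⟩⟩
  isStableUnderShiftBy a := .mk fun X hX => by
    exact HomFinite.of_injective hX (add_right_injective a) (fun j =>
      (Linear.homCongr R ((shiftFunctorAdd C a j).symm.app X) (Iso.refl _)).toLinearMap)
        fun j => LinearEquiv.injective _
  toIsTriangulatedClosed₂ := .mk' fun T hT h₁ h₃ =>
    HomFinite.of_exact h₃ h₁ (fun j => Linear.leftComp R _ (T.mor₂⟦j⟧'))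
      (fun j => Linear.leftComp R _ (T.mor₁⟦j⟧')) fun j y => by
        have hT' := Triangle.shift_distinguished T hT j
        refine ⟨fun hy => ?_, ?_⟩
        -- Shifting a distinguished triangle twists its maps by (-1)^j; the sign is absorbed into
        -- `z`.
        · have hy' : (j.negOnePow • T.mor₁⟦j⟧') ≫ y = 0 := by
            have hy : T.mor₁⟦j⟧' ≫ y = 0 := hy
            rw [Linear.units_smul_comp, hy, smul_zero]
          obtain ⟨z : T.obj₃⟦j⟧ ⟶ Y, hz : y = (j.negOnePow • T.mor₂⟦j⟧') ≫ z⟩ :=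
            Triangle.yoneda_exact₂ _ hT' y hy'
          refine ⟨j.negOnePow • z, ?_⟩
          rw [hz, Linear.leftComp_apply, Linear.comp_units_smul, Linear.units_smul_comp]
        · rintro ⟨z, rfl⟩
          simp [← Functor.map_comp_assoc, comp_distTriang_mor_zero₁₂ _ hT]

/-- Finiteness of the graded endomorphisms of a split-generator implies finiteness of all
graded morphism modules. -/
lemma IsSplitGenerator.homFinite {b : Prop} {G : C} (hG : IsSplitGenerator G)
    (h : HomFinite R b G G) (X Y : C) : HomFinite R b X Y := by
  have htop (Q : ObjectProperty C) [Q.IsStableUnderRetracts] [Q.IsTriangulated] (hQ : Q G)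
      (Z : C) : Q Z := by
    have hle : (ObjectProperty.singleton G).triangEnvelope ≤ Q := by
      rw [ObjectProperty.triangEnvelope_le_iff]
      simpa using hQ
    rw [hG] at hle
    exact hle Z trivial
  exact htop (homFiniteSource R b Y) (htop (homFiniteTarget R b G) h Y) X

end Finiteness

/-! ### Periodicity of shifts for finite m. -/

section Periodicity

variable {C : Type*} [Category* C] [HasShift C ℤ]

lemma nonempty_shift_mul_iso {m : ℤ} (e : shiftFunctor C m ≅ 𝟭 C) (X : C) (q : ℤ) :
    Nonempty (X⟦m * q⟧ ≅ X) := by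
  induction q with
  | zero => exact ⟨(shiftFunctorZero' C _ (mul_zero m)).app X⟩
  | succ q ih =>
    obtain ⟨i⟩ := ih
    exact ⟨(shiftFunctorAdd' C (m * q) m _ (by ring)).app X ≪≫ e.app _ ≪≫ i⟩
  | pred q ih =>
    obtain ⟨i⟩ := ih
    exact ⟨(e.app _).symm ≪≫ ((shiftFunctorAdd' C _ m (m * -q) (by ring)).app X).symm ≪≫ i⟩

lemma nonempty_shift_iso_of_dvd {m : ℤ} (e : shiftFunctor C m ≅ 𝟭 C) (X : C) {i j : ℤ}
    (h : m ∣ j - i) : Nonempty (X⟦i⟧ ≅ X⟦j⟧) := by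
  obtain ⟨q, hq⟩ := h
  obtain ⟨f⟩ := nonempty_shift_mul_iso e (X⟦i⟧) q
  exact ⟨f.symm ≪≫ ((shiftFunctorAdd' C i (m * q) j (by lia)).app X).symm⟩

end Periodicity

/-! ### Nonzero ghost composites from chains of primes. -/

section GhostConstruction

open Pretriangulated

variable {R : Type*} [CommRing R] {C : Type*} [Category* C] [HasShift C ℤ]
  [Preadditive C] [Linear R C]

lemma exists_pow_smul_eq_zero_of_finite {G X : C} (hN : ∀ j : ℤ, IsNoetherian R (G⟦j⟧ ⟶ X))
    {S : Set ℤ} (hS : S.Finite)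
    (h : ∀ j : ℤ, Subsingleton (G⟦j⟧ ⟶ X) ∨ ∃ i ∈ S, Nonempty (G⟦i⟧ ≅ G⟦j⟧)) (x : R) :
    ∃ N : ℕ, ∀ (j : ℤ) (f : G⟦j⟧ ⟶ X) (a : ℕ), x ^ a • f = 0 → x ^ N • f = 0 := by
  choose N hN using fun j : ℤ => exists_pow_smul_eq_zero_of_isNoetherian (M := G⟦j⟧ ⟶ X) x
  refine ⟨hS.toFinset.sup N, fun j f a hf => ?_⟩
  obtain hj | ⟨i, hi, ⟨e⟩⟩ := h j
  · exact Subsingleton.elim _ _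
  · have := hN i _ (Finset.le_sup (hS.mem_toFinset.2 hi)) (e.hom ≫ f) a
      (by rw [← Linear.comp_smul, hf, comp_zero])
    rwa [← Linear.comp_smul, ← comp_zero, cancel_epi] at this

/-- One exponent must serve all shifts at once: a maximum over the nonzero degrees, or over residues
modulo the period. -/
lemma HomFinite.exists_pow_smul_eq_zero {b : Prop} {G X : C} (h : HomFinite R b G X)
    (hb : ¬ b → ∃ m : ℤ, 0 < m ∧ Nonempty (shiftFunctor C m ≅ 𝟭 C)) (x : R) :
    ∃ N : ℕ, ∀ (j : ℤ) (f : G⟦j⟧ ⟶ X) (a : ℕ), x ^ a • f = 0 → x ^ N • f = 0 := by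
  by_cases hb' : b
  · refine exists_pow_smul_eq_zero_of_finite h.isNoetherian (h.finite hb') (fun j => ?_) x
    rw [or_iff_not_imp_left]
    exact fun hj => ⟨j, hj, ⟨Iso.refl _⟩⟩
  · obtain ⟨m, hm, ⟨e⟩⟩ := hb hb'
    exact exists_pow_smul_eq_zero_of_finite h.isNoetherian (Set.finite_Ico 0 m) (fun j =>
      .inr ⟨j % m, ⟨Int.emod_nonneg j hm.ne', Int.emod_lt_of_pos j hm⟩,
        nonempty_shift_iso_of_dvd e G (Int.dvd_self_sub_emod)⟩) x

variable [HasZeroObject C] [∀ n : ℤ, (shiftFunctor C n).Additive] [Pretriangulated C]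

/-- If `u : X ⟶ Z` is nonzero at the prime `p`, then for every larger prime `q` there is a ghost
`δ` with `δ ≫ u` nonzero at `q`. It is a multiple of the fiber inclusion of the multiplication on
`X` by a high power of an element of `q \ p`. -/
lemma exists_ghost_comp_of_lt [IsNoetherianRing R] {G X Z : C} [IsNoetherian R (X ⟶ Z)]
    (hX : ∀ x : R, ∃ N : ℕ, ∀ (j : ℤ) (f : G⟦j⟧ ⟶ X) (a : ℕ), x ^ a • f = 0 → x ^ N • f = 0)
    {p q : PrimeSpectrum R} (hpq : p < q) (u : X ⟶ Z)
    (hu : ∀ r : R, r • u = 0 → r ∈ p.asIdeal) :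
    ∃ (F : C) (δ : F ⟶ X), shiftKilledBy δ G ∧ ∀ r : R, r • (δ ≫ u) = 0 → r ∈ q.asIdeal := by
  obtain ⟨x, hxq, hxp⟩ := SetLike.exists_of_lt (show p.asIdeal < q.asIdeal from hpq)
  obtain ⟨N, hN⟩ := hX x
  -- Since x ∉ p and p ≤ q, the map `x ^ N • u` is still nonzero at q. The exponent `a` depends on
  -- `N`, but `N` serves every `a`.
  obtain ⟨a, ha⟩ := exists_mem_of_smul_mem_pow_smul q.asIdeal hxq (x ^ N • u) fun r hr =>
    hpq.le ((p.2.mem_or_mem (hu (r * x ^ N) (by rw [mul_smul, hr]))).resolve_right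
      fun h => hxp (p.2.mem_of_pow_mem N h))
  obtain ⟨F, d, c, hT⟩ := distinguished_cocone_triangle₁ (x ^ a • 𝟙 X)
  have hd : x ^ a • d = 0 := by
    have : d ≫ (x ^ a • 𝟙 X) = 0 := comp_distTriang_mor_zero₁₂ _ hT
    rwa [Linear.comp_smul, Category.comp_id] at this
  refine ⟨F, x ^ N • d, fun j h => ?_, fun r hr => ?_⟩
  · rw [Linear.comp_smul]
    exact hN j _ a (by rw [← Linear.comp_smul, hd, comp_zero])
  -- A map vanishing on the fibre of x^a factors through x^a, hence lies in x^a Hom(X, Z).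
  · have hr' : d ≫ (r • x ^ N • u) = 0 := by
      rw [← hr, Linear.smul_comp, Linear.comp_smul, Linear.comp_smul]
    obtain ⟨t : X ⟶ Z, ht : _ = (x ^ a • 𝟙 X) ≫ t⟩ := Triangle.yoneda_exact₂ _ hT _ hr'
    exact ha r t (by rw [ht, Linear.smul_comp, Category.id_comp])

lemma exists_isGhostComposite [IsNoetherianRing R] {G : C}
    (hN : ∀ X Y : C, IsNoetherian R (X ⟶ Y))
    (hX : ∀ (X : C) (x : R), ∃ N : ℕ, ∀ (j : ℤ) (f : G⟦j⟧ ⟶ X) (a : ℕ),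
      x ^ a • f = 0 → x ^ N • f = 0)
    (s : LTSeries (PrimeSpectrum R)) (hs : ∀ r : R, r • 𝟙 G = 0 → r ∈ s.head.asIdeal) (n : ℕ)
    (hn : n < s.length + 1) :
    ∃ (X : C) (u : X ⟶ G), IsGhostComposite G n u ∧
      ∀ r : R, r • u = 0 → r ∈ (s ⟨n, hn⟩).asIdeal := by
  induction n with
  | zero => exact ⟨G, 𝟙 G, .id G, hs⟩
  | succ n ih =>
    obtain ⟨X, u, hu, hu'⟩ := ih (by lia)
    have := hN X G
    obtain ⟨F, δ, hδ, h⟩ := exists_ghost_comp_of_lt (hX X)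
      (s.strictMono (show (⟨n, by lia⟩ : Fin (s.length + 1)) < ⟨n + 1, hn⟩ by simp)) u hu'
    exact ⟨F, δ ≫ u, .comp _ _ hδ hu, h⟩

/-- An element of `R` that kills `G` acts nilpotently on all objects built from `G`. -/
lemma pow_smul_id_eq_zero_of_triangEnvelopeIter [∀ n : ℤ, (shiftFunctor C n).Linear R] {G X : C}
    {n : ℕ} (hX : (ObjectProperty.singleton G).triangEnvelopeIter n X) {r : R}
    (hr : r • 𝟙 G = 0) : r ^ (n + 1) • 𝟙 X = 0 := by
  -- Multiplication by `r` on `X` is itself a `G`-ghost.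
  have hghost : shiftKilledBy (r • 𝟙 X) G := fun j h => by
    rw [Linear.comp_smul, Category.comp_id, ← Category.id_comp h, ← Linear.smul_comp,
      ← (shiftFunctor C j).map_id, ← Functor.map_smul, hr, Functor.map_zero, zero_comp]
  have (k : ℕ) : IsGhostComposite G k (r ^ k • 𝟙 X) := by
    induction k with
    | zero => simpa using .id X
    | succ k ih =>
      have := IsGhostComposite.comp _ _ hghost ih
      rwa [Linear.smul_comp, Category.id_comp, smul_smul, ← pow_succ'] at this
  simpa using (this (n + 1)).comp_eq_zero hX (𝟙 X)

lemma length_le_of_triangEnvelopeIter_eq_top [IsNoetherianRing R]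
    [∀ n : ℤ, (shiftFunctor C n).Linear R] {b : Prop} (hF : ∀ X Y : C, HomFinite R b X Y)
    (hb : ¬ b → ∃ m : ℤ, 0 < m ∧ Nonempty (shiftFunctor C m ≅ 𝟭 C)) {G G' : C} {n : ℕ}
    (hG' : (ObjectProperty.singleton G').triangEnvelopeIter n = ⊤)
    (s : LTSeries (PrimeSpectrum R)) (hs : ∀ r : R, r • 𝟙 G = 0 → r ∈ s.head.asIdeal) :
    s.length ≤ n := by
  have hW (W : C) : (ObjectProperty.singleton G').triangEnvelopeIter n W := by
    rw [hG']; trivial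
  by_contra! hlt
  obtain ⟨X, u, hu, hu'⟩ := exists_isGhostComposite (R := R) (G := G')
    (fun X Y => have := (hF X Y).isNoetherian 0
      isNoetherian_of_linearEquiv (Linear.homCongr R ((shiftFunctorZero C ℤ).app X) (Iso.refl Y)))
    (fun X => (hF G' X).exists_pow_smul_eq_zero hb) s
    -- The composites end at `G'`, while `hs` concerns `G`: if `r` kills `G'`, a power of `r` kills
    -- `G`, and p₀ is prime.
    (fun r hr => s.head.2.mem_of_pow_mem _
      (hs _ (pow_smul_id_eq_zero_of_triangEnvelopeIter (hW G) hr))) (n + 1) (by lia)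
  have hu₀ : u = 0 := by simpa using hu.comp_eq_zero (hW X) (𝟙 X)
  exact (s ⟨n + 1, by lia⟩).2.ne_top ((Ideal.eq_top_iff_one _).2 (hu' 1 (by rw [hu₀, smul_zero])))

end GhostConstruction

/-- Finitely many generators have finite joint support. -/
lemma DirectSum.finite_not_subsingleton_of_isNoetherian {R ι : Type*} [Ring R] {M : ι → Type*}
    [∀ i, AddCommGroup (M i)] [∀ i, Module R (M i)] [IsNoetherian R (⨁ i, M i)] :
    {i | ¬ Subsingleton (M i)}.Finite := by
  classical
  obtain ⟨s, hs⟩ := IsNoetherian.noetherian (⊤ : Submodule R (⨁ i, M i))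
  let S := s.biUnion fun x => DFinsupp.support x
  refine S.finite_toSet.subset fun i hi => by_contra fun hiS => hi ?_
  have hle : (⊤ : Submodule R (⨁ i, M i)) ≤ LinearMap.ker (DirectSum.component R ι M i) := by
    rw [← hs, Submodule.span_le]
    intro x hx
    by_contra hxi
    exact hiS (Finset.mem_biUnion.2 ⟨x, hx, DFinsupp.mem_support_iff.2 hxi⟩)
  refine subsingleton_of_forall_eq 0 fun y => ?_
  have := hle (x := DirectSum.lof R ι M i y) trivial
  rwa [LinearMap.mem_ker, DirectSum.component.lof_self] at this

/-! ### Linear structure from a central action. -/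

section CentralAction

variable {C : Type*} [Category* C] [HasShift C ℤ] [Preadditive C]
  [∀ n : ℤ, (shiftFunctor C n).Additive]

/-- A central endomorphism commuting with the shift functor commutes with all its powers. -/
lemma map_shift_app_of_mem_gradedCenterZero {z : CatCenter C} (hz : z ∈ gradedCenterZero C)
    (a : ℤ) (X : C) : (z.app X)⟦a⟧' = z.app (X⟦a⟧) := by
  have hadd (a b c : ℤ) (h : a + b = c) (X : C) : (z.app X)⟦c⟧' = z.app (X⟦c⟧) ↔
      (z.app X)⟦a⟧'⟦b⟧' = z.app (X⟦a⟧⟦b⟧) := by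
    have h₁ := (shiftFunctorAdd' C a b c h).hom.naturality (z.app X)
    have h₂ := z.naturality ((shiftFunctorAdd' C a b c h).hom.app X)
    dsimp at h₁ h₂
    rw [← cancel_mono ((shiftFunctorAdd' C a b c h).hom.app X), h₁, ← h₂, cancel_epi]
  have hone (X : C) : (z.app X)⟦(1 : ℤ)⟧' = z.app (X⟦(1 : ℤ)⟧) := (hz X).symm
  induction a generalizing X with
  | zero =>
    have h₁ := (shiftFunctorZero C ℤ).hom.naturality (z.app X)
    have h₂ := z.naturality ((shiftFunctorZero C ℤ).hom.app X)
    dsimp at h₁ h₂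
    rw [← cancel_mono ((shiftFunctorZero C ℤ).hom.app X), h₁, ← h₂]
  | succ a ih => rw [hadd a 1 _ rfl, ih, hone]
  | pred a ih =>
    apply (shiftFunctor C (1 : ℤ)).map_injective
    rw [hone, ← hadd (-a - 1) 1 (-a) (by lia), ih]

variable {R : Type*} [CommRing R]

/-- The `R`-linear structure on `C` given by a central action. -/
abbrev CentralAction.linear (φ : CentralAction C R) : Linear R C :=
  Linear.ofRingMorphism ((gradedCenterZero C).subtype.comp φ)

lemma CentralAction.shiftFunctor_linear (φ : CentralAction C R) (a : ℤ) :
    letI := φ.linear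
    (shiftFunctor C a).Linear R := by
  let := φ.linear
  rw [Functor.linear_iff]
  intro X r
  change ((φ r).1.app X ≫ 𝟙 X)⟦a⟧' = (φ r).1.app (X⟦a⟧) ≫ 𝟙 (X⟦a⟧)
  rw [Category.comp_id, Category.comp_id, map_shift_app_of_mem_gradedCenterZero (φ r).2]

lemma CentralAction.homFinite (φ : CentralAction C R) {m : ℕ∞} (hm : 1 ≤ m)
    (hC : IsCyclicallyGraded C m) (G : C) (hN : IsNoetherian R (GradedHom φ m G G)) :
    letI := φ.linear
    HomFinite R (m = ⊤) G G := by
  let := φ.linear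
  have := φ.shiftFunctor_linear
  have hdeg (i : ℤ) (hi : i ∈ gradingDegrees m) : IsNoetherian R (G ⟶ G⟦i⟧) := by
    classical
    exact isNoetherian_of_injective
      (DirectSum.lof R (gradingDegrees m) (fun i => HomInDegree φ G G i) ⟨i, hi⟩)
      (DirectSum.of_injective (β := fun i : gradingDegrees m => HomInDegree φ G G i) _)
  refine ⟨fun j => ?_, fun hmt => ?_⟩
  · suffices IsNoetherian R (G ⟶ G⟦-j⟧) from
      isNoetherian_of_linearEquiv (homShiftNegLinearEquiv R G G j (-j) (by simp))
    induction m with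
    | top => exact hdeg _ (by simp [gradingDegrees])
    | coe m =>
      obtain ⟨e⟩ := hC m rfl
      have hm' : (0 : ℤ) < m := by exact_mod_cast hm
      -- The representative of -j modulo m in 1, …, m, rather than 0, …, m - 1.
      obtain ⟨f⟩ := nonempty_shift_iso_of_dvd e G (i := 1 + (-j - 1) % m) (j := -j)
        (by rw [← sub_sub]; exact Int.dvd_self_sub_emod)
      have := hdeg (1 + (-j - 1) % m) (by
        have h₁ := Int.emod_nonneg (-j - 1) hm'.ne'
        have h₂ := Int.emod_lt_of_pos (-j - 1) hm'
        simp only [gradingDegrees, ENat.natCast_ne_top, if_false, ENat.toNat_natCast, Set.mem_Icc]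
        lia)
      exact isNoetherian_of_linearEquiv (Linear.homCongr R (Iso.refl G) f)
  · subst hmt
    have hfin := DirectSum.finite_not_subsingleton_of_isNoetherian
      (R := R) (M := fun i : gradingDegrees ⊤ => HomInDegree φ G G i)
    refine ((hfin.image Subtype.val).preimage (f := fun j : ℤ => -j)
      neg_injective.injOn).subset fun j hj => ⟨⟨-j, by simp [gradingDegrees]⟩, fun hs => hj ?_, rfl⟩
    have : Subsingleton (G ⟶ G⟦-j⟧) := hs
    exact (homShiftNegLinearEquiv R G G j (-j) (by simp)).symm.injective.subsingleton

end CentralAction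

theorem theorem1p9
    {C : Type*} [Category* C] [HasZeroObject C] [HasShift C ℤ] [Preadditive C]
    [∀ n : ℤ, (shiftFunctor C n).Additive] [Pretriangulated C] [IsTriangulated C]
    (m : ℕ∞) (hm : 1 ≤ m) (hC : IsCyclicallyGraded C m)
    (k : Type*) [Field k] (R : Type*) [CommRing R] [Algebra k R] [Algebra.FiniteType k R]
    (φ : CentralAction C R)
    (G : C) (hG : IsSplitGenerator G) (hN : IsNoetherian R (GradedHom φ m G G)) :
    moduleKrullDim R (GradedHom φ m G G) ≤ (rouquierDim C : WithBot ℕ∞) := by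
  let := φ.linear
  have := φ.shiftFunctor_linear
  have : IsNoetherianRing R := Algebra.FiniteType.isNoetherianRing k R
  have hF : ∀ X Y : C, HomFinite R (m = ⊤) X Y :=
    hG.homFinite (φ.homFinite hm hC G hN)
  have hper : ¬ m = ⊤ → ∃ n : ℤ, 0 < n ∧ Nonempty (shiftFunctor C n ≅ 𝟭 C) := fun hmt => by
    lift m to ℕ using hmt
    exact ⟨m, by exact_mod_cast hm, hC m rfl⟩
  refine iSup_le fun s => ?_
  -- Chains in the quotient pull back to chains of primes of `R` containing the annihilator.
  have hinj : StrictMono (PrimeSpectrum.comap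
      (Ideal.Quotient.mk (Module.annihilator R (GradedHom φ m G G)))) :=
    Monotone.strictMono_of_injective (fun _ _ h => Ideal.comap_mono h)
      (PrimeSpectrum.comap_injective_of_surjective _ Ideal.Quotient.mk_surjective)
  have hs (r : R) (hr : r • 𝟙 G = 0) : r ∈ (s.map _ hinj).head.asIdeal := by
    have hr' : r ∈ Module.annihilator R (GradedHom φ m G G) := by
      rw [Module.mem_annihilator]
      intro x
      refine DFinsupp.ext fun i => ?_
      have (f : G ⟶ G⟦(i : ℤ)⟧) : r • f = 0 := by
        rw [← Category.id_comp f, ← Linear.smul_comp, hr, zero_comp]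
      exact this (x i)
    rw [LTSeries.head_map]
    change Ideal.Quotient.mk _ r ∈ s.head.asIdeal
    rw [Ideal.Quotient.eq_zero_iff_mem.2 hr']
    exact zero_mem _
  have key : (s.length : ℕ∞) ≤ rouquierDim C := by
    refine le_sInf ?_
    rintro _ ⟨n, rfl, G', hG'⟩
    exact_mod_cast length_le_of_triangEnvelopeIter_eq_top hF hper hG' (s.map _ hinj) hs
  exact_mod_cast key
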